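/- Let $\Bbbk$ be a field of characteristic zero, let $k\ge 1$ be an integer, put $n=2k-1$, and let $\alpha_1,\dots,\alpha_{n+2}\in\Bbbk$ be pairwise distinct. Let the polynomial ring $\Bbbk[x_1,\dots,x_n]$ act on $\Bbbk[X_1,\dots,X_n]$ by letting $x_j$ act as $\partial/\partial X_j$, and write $f\circ G$ for this action. Consider the linear forms $\ell_i=\sum_{j=1}^{n}\alpha_i^{\,j-1}x_j$ for $i=1,\dots,n+2$. Then the $k\times k$ Hankel determinant $$F=\det\bigl(X_{i+j-1}\bigr)_{1\le i,j\le k}$$ is, up to a scalar factor, the unique nonzero form of degree $k=(n+1)/2$ in $\Bbbk[X_1,\dots,X_n]$ that is annihilated by $\ell_1^2,\dots,\ell_{n+2}^2$. That is, $F$ is nonzero and homogeneous of degree $k$, it satisfies $\ell_i^2\circ F=0$ for $i=1,\dots,n+2$, and every form $G$ of degree $k$ with $\ell_i^2\circ G=0$ for $i=1,\dots,n+2$ is a scalar multiple of $F$. -/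

import Mathlib

noncomputable section

open MvPolynomial

/-- The partial derivative `∂ / ∂X_i`, as a linear endomorphism of the polynomial ring. -/
def pderivEnd {σ : Type*} (K : Type*) [Field K] (i : σ) : Module.End K (MvPolynomial σ K) :=
  (pderiv i).toLinearMap

theorem pderivEnd_comm {σ : Type*} (K : Type*) [Field K] (i j : σ) :
    pderivEnd K i * pderivEnd K j = pderivEnd K j * pderivEnd K i := by
  classical
  have h : ⁅(pderiv i : Derivation K (MvPolynomial σ K) (MvPolynomial σ K)),
      (pderiv j : Derivation K (MvPolynomial σ K) (MvPolynomial σ K))⁆ = 0 := by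
    apply MvPolynomial.derivation_ext
    intro l
    rw [Derivation.commutator_apply]
    simp only [pderiv_X, Derivation.coe_zero, Pi.zero_apply, Pi.single_apply]
    split_ifs <;> simp
  refine LinearMap.ext fun p => ?_
  have hp := congrArg (fun D => D p) h
  simp only [Derivation.commutator_apply, Derivation.coe_zero, Pi.zero_apply] at hp
  exact sub_eq_zero.mp hp

/-- The algebra of constant-coefficient differential operators: the subalgebra generated by the
partial derivatives inside the endomorphisms of `K[X_s : s ∈ σ]`. -/
def constCoeffDiffOps (σ K : Type*) [Field K] :
    Subalgebra K (Module.End K (MvPolynomial σ K)) :=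
  Algebra.adjoin K (Set.range fun i : σ => pderivEnd K i)

instance constCoeffDiffOps_isMulCommutative (σ K : Type*) [Field K] :
    IsMulCommutative (constCoeffDiffOps σ K) :=
  Algebra.isMulCommutative_adjoin K (by
    rintro _ ⟨i, rfl⟩ _ ⟨j, rfl⟩
    exact pderivEnd_comm K i j)

open scoped IsMulCommutative in
/-- The action `f ∘ G` of the polynomial ring on the dual polynomial ring: the algebra
homomorphism to the endomorphisms that sends each variable `x_i` to `∂ / ∂X_i`. -/
def diffAction (σ K : Type*) [Field K] :
    MvPolynomial σ K →ₐ[K] Module.End K (MvPolynomial σ K) :=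
  (constCoeffDiffOps σ K).val.comp
    (aeval fun i : σ =>
      (⟨pderivEnd K i, Algebra.subset_adjoin ⟨i, rfl⟩⟩ : constCoeffDiffOps σ K))

theorem diffAction_X {σ K : Type*} [Field K] (i : σ) (G : MvPolynomial σ K) :
    diffAction σ K (X i) G = pderiv i G := by
  simp [diffAction, pderivEnd]

/-- The linear form `∑_{j=1}^n a^(j-1) x_j` of the point with parameter `a` on the moment curve
(variables are indexed from `0`). -/
def momentForm {K : Type*} [Field K] (n : ℕ) (a : K) : MvPolynomial (Fin n) K :=
  ∑ j : Fin n, C (a ^ (j : ℕ)) * X j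

/-- The `k × k` Hankel matrix of the variables: with variables, rows and columns indexed
from `0`, its `(i, j)` entry is the variable with index `i + j`. -/
def hankelMatrix (K : Type*) [Field K] (k : ℕ) :
    Matrix (Fin k) (Fin k) (MvPolynomial (Fin (2 * k - 1)) K) :=
  Matrix.of fun i j => X ⟨(i : ℕ) + (j : ℕ), by omega⟩

end

noncomputable section

open MvPolynomial

/-! Apolarity turns a form G of degree k into the functional L(f) = (f ∘ G)(0), which lives in
degree k and determines G; squares annihilating G become multiples killed by L. Write ℓ(s) for the
moment form with parameter s. Everything is then a count of zeros of the one-variable polynomials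
P(s) = L(f ℓ(s)^m), of degree at most m(2k-2).

First, L kills the multiples of ℓ(s)^2 for every s, not only at the α_i
(`map_momentForm_sq_mul_eq_zero`). This goes by descent on powers of ℓ(s), taking f to be a product
of moment forms: the α_i and the points of f force more zeros on P than its degree allows.

Second, with all squares killed, L(ℓ(t_1)⋯ℓ(t_k)), as a polynomial in one t_i, has double zeros at
the other k-1 points and degree at most 2k-2. One vanishing value therefore spreads to all products
of k distinct points, and L = 0 (`eq_zero_of_map_prod_momentForm_eq_zero`). So the solution space is
at most a line, and the Hankel determinant, annihilated by every ℓ(s)^2, spans it. -/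

/-- Apply a linear functional to every coefficient of a polynomial. -/
def coeffwise {K A : Type*} [Field K] [CommRing A] [Algebra K A] (L : A →ₗ[K] K) :
    Polynomial A →ₗ[K] Polynomial K :=
  Polynomial.lsum fun i => (Polynomial.monomial i).restrictScalars K ∘ₗ L

/-! ### Zeros of one-variable polynomials obtained from a functional -/

section Coeffwise

variable {K A : Type*} [Field K] [CommRing A] [Algebra K A] (L : A →ₗ[K] K)

theorem coeff_coeffwise (p : Polynomial A) (i : ℕ) :
    (coeffwise L p).coeff i = L (p.coeff i) := by
  induction p using Polynomial.induction_on' with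
  | add p q hp hq => simp [hp, hq]
  | monomial n a =>
    rw [coeffwise, Polynomial.lsum_apply, Polynomial.sum_monomial_index _ _ (by simp)]
    simp only [LinearMap.comp_apply, LinearMap.restrictScalars_apply, Polynomial.coeff_monomial]
    split_ifs <;> simp

theorem eval_coeffwise (p : Polynomial A) (t : K) :
    (coeffwise L p).eval t = L (p.eval (algebraMap K A t)) := by
  induction p using Polynomial.induction_on' with
  | add p q hp hq => simp [hp, hq]
  | monomial n a =>
    rw [coeffwise, Polynomial.lsum_apply, Polynomial.sum_monomial_index _ _ (by simp)]
    simp only [LinearMap.comp_apply, LinearMap.restrictScalars_apply, Polynomial.eval_monomial]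
    rw [mul_comm a, ← map_pow, ← Algebra.smul_def, map_smul, smul_eq_mul, mul_comm]

theorem derivative_coeffwise (p : Polynomial A) :
    Polynomial.derivative (coeffwise L p) = coeffwise L (Polynomial.derivative p) := by
  ext i
  rw [Polynomial.coeff_derivative, coeff_coeffwise, coeff_coeffwise, Polynomial.coeff_derivative]
  have : p.coeff (i + 1) * ((i : A) + 1) = ((i : K) + 1) • p.coeff (i + 1) := by
    rw [Algebra.smul_def, mul_comm]; simp
  rw [this, map_smul, smul_eq_mul, mul_comm]

theorem coeffwise_map_mul (p : Polynomial K) (q : Polynomial A) :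
    coeffwise L (p.map (algebraMap K A) * q) = p * coeffwise L q := by
  ext i
  simp only [coeff_coeffwise, Polynomial.coeff_mul, Polynomial.coeff_map, map_sum,
    ← Algebra.smul_def, map_smul, smul_eq_mul]

theorem natDegree_coeffwise_le (p : Polynomial A) :
    (coeffwise L p).natDegree ≤ p.natDegree := by
  refine Polynomial.natDegree_le_iff_coeff_eq_zero.2 fun N hN => ?_
  rw [coeff_coeffwise, Polynomial.coeff_eq_zero_of_natDegree_lt hN, map_zero]

variable (ℓ : Polynomial A)

/-- Modulo `e ^ 2` only the first two binomial terms survive, and both contain `d ^ n`. -/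
theorem exists_pow_succ_eq_square_mul_add {R : Type*} [CommRing R] (e d m : R) (n : ℕ) :
    ∃ u w z : R, (e + d * m) ^ (n + 1) = e ^ 2 * u + d ^ n * (e * w + d * z) := by
  induction n with
  | zero => exact ⟨0, 1, m, by ring⟩
  | succ n ih =>
    obtain ⟨u, w, z, h⟩ := ih
    refine ⟨u * (e + d * m) + d ^ n * w, w * m + z, z * m, ?_⟩
    rw [pow_succ, h]; ring

/-- If `L` kills the ideal generated by the square of a value `ℓ(t)`, then `L(f ℓ(s)^(n+1))` vanishes
to order `n` at `s = t`. -/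
theorem pow_dvd_coeffwise {t : K}
    (h : ∀ f, L (ℓ.eval (algebraMap K A t) ^ 2 * f) = 0) (f : A) (n : ℕ) :
    (Polynomial.X - Polynomial.C t) ^ n ∣ coeffwise L (Polynomial.C f * ℓ ^ (n + 1)) := by
  obtain ⟨m, hm⟩ := Polynomial.X_sub_C_dvd_sub_C_eval (a := algebraMap K A t) (p := ℓ)
  obtain ⟨u, w, z, h1⟩ := exists_pow_succ_eq_square_mul_add
    (Polynomial.C (ℓ.eval (algebraMap K A t))) (Polynomial.X - Polynomial.C (algebraMap K A t)) m n
  rw [← hm, add_sub_cancel] at h1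
  set e := ℓ.eval (algebraMap K A t)
  have h2 : Polynomial.C f * ℓ ^ (n + 1) = Polynomial.C (e ^ 2) * (Polynomial.C f * u) +
      ((Polynomial.X - Polynomial.C t) ^ n).map (algebraMap K A) *
        (Polynomial.C f * (Polynomial.C e * w +
          (Polynomial.X - Polynomial.C (algebraMap K A t)) * z)) := by
    rw [h1]
    simp only [Polynomial.map_pow, Polynomial.map_sub, Polynomial.map_X, Polynomial.map_C,
      Polynomial.C_pow]
    ring
  have h3 : coeffwise L (Polynomial.C (e ^ 2) * (Polynomial.C f * u)) = 0 := by
    ext i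
    rw [coeff_coeffwise, Polynomial.coeff_C_mul, h, Polynomial.coeff_zero]
  rw [h2, map_add, h3, zero_add, coeffwise_map_mul]
  exact dvd_mul_right _ _

/-- If `L` kills all multiples of `ℓ(s)^(n+1)`, for all `s`, then `L(f ℓ(t) ℓ(s)^n)` has a double
zero at `s = t`. -/
theorem sq_dvd_coeffwise [CharZero K] {n : ℕ} (hn : 0 < n)
    (h : ∀ s f, L (ℓ.eval (algebraMap K A s) ^ (n + 1) * f) = 0) (f : A) (t : K) :
    (Polynomial.X - Polynomial.C t) ^ 2 ∣
      coeffwise L (Polynomial.C (ℓ.eval (algebraMap K A t) * f) * ℓ ^ n) := by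
  -- Differentiate the identity L(f ℓ(s)^(n+1)) = 0 in s and divide by n+1, using characteristic
  -- zero.
  have hder : coeffwise L (Polynomial.C f * (ℓ ^ n * Polynomial.derivative ℓ)) = 0 := by
    have h0 : coeffwise L (Polynomial.C f * ℓ ^ (n + 1)) = 0 := by
      refine Polynomial.funext fun s => ?_
      rw [eval_coeffwise, Polynomial.eval_mul, Polynomial.eval_C, Polynomial.eval_pow, mul_comm,
        h, Polynomial.eval_zero]
    have h1 := derivative_coeffwise L (Polynomial.C f * ℓ ^ (n + 1))
    rw [h0, Polynomial.derivative_zero, Polynomial.derivative_C_mul,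
      Polynomial.derivative_pow_succ] at h1
    have h2 : Polynomial.C f * (Polynomial.C ((n : A) + 1) * ℓ ^ n * Polynomial.derivative ℓ) =
        (Polynomial.C ((n : K) + 1)).map (algebraMap K A) *
          (Polynomial.C f * (ℓ ^ n * Polynomial.derivative ℓ)) := by
      simp only [map_add, map_natCast, map_one, Polynomial.map_add, Polynomial.map_natCast,
        Polynomial.map_one]
      ring
    rw [h2, coeffwise_map_mul] at h1
    refine (mul_eq_zero.1 h1.symm).resolve_left ?_
    rw [Polynomial.C_eq_zero]
    exact Nat.cast_add_one_ne_zero n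
  set P := coeffwise L (Polynomial.C (ℓ.eval (algebraMap K A t) * f) * ℓ ^ n) with hP
  by_cases hP0 : P = 0
  · rw [hP0]; exact dvd_zero _
  rw [← Polynomial.le_rootMultiplicity_iff hP0]
  refine (Polynomial.one_lt_rootMultiplicity_iff_isRoot hP0).2 ⟨?_, ?_⟩
  · rw [Polynomial.IsRoot, hP, eval_coeffwise, Polynomial.eval_mul, Polynomial.eval_C,
      Polynomial.eval_pow, ← h t f]
    congr 1; ring
  · obtain ⟨m, rfl⟩ := Nat.exists_eq_add_of_lt hn
    have h1 := congrArg (Polynomial.eval t) hder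
    rw [eval_coeffwise] at h1
    rw [Polynomial.IsRoot, hP, derivative_coeffwise, eval_coeffwise]
    simp only [zero_add, Polynomial.eval_mul, Polynomial.eval_C, Polynomial.eval_pow,
      Polynomial.eval_zero, Polynomial.derivative_C_mul, Polynomial.derivative_pow_succ] at h1 ⊢
    set e := ℓ.eval (algebraMap K A t)
    have h3 : e * f * (((m : A) + 1) * e ^ m * (Polynomial.derivative ℓ).eval (algebraMap K A t)) =
        ((m : K) + 1) •
          (f * (e ^ (m + 1) * (Polynomial.derivative ℓ).eval (algebraMap K A t))) := by
      rw [Algebra.smul_def]; simp only [map_add, map_natCast, map_one]; ring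
    rw [h3, map_smul, h1, smul_zero]

theorem natDegree_coeffwise_pow_le (f : A) (n : ℕ) :
    (coeffwise L (Polynomial.C f * ℓ ^ n)).natDegree ≤ n * ℓ.natDegree :=
  (natDegree_coeffwise_le L _).trans
    ((Polynomial.natDegree_C_mul_le _ _).trans Polynomial.natDegree_pow_le)

end Coeffwise

theorem prod_pow_dvd_of_injOn {K ι : Type*} [Field K] (s : Finset ι) (x : ι → K)
    (hx : Set.InjOn x s) (e : ℕ) (P : Polynomial K)
    (h : ∀ i ∈ s, (Polynomial.X - Polynomial.C (x i)) ^ e ∣ P) :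
    ∏ i ∈ s, (Polynomial.X - Polynomial.C (x i)) ^ e ∣ P := by
  refine Finset.prod_dvd_of_coprime (fun i hi j hj hij => ?_) h
  refine IsCoprime.pow ?_
  exact Polynomial.isCoprime_X_sub_C_of_isUnit_sub
    (sub_ne_zero.2 fun hh => hij (hx hi hj hh)).isUnit

theorem natDegree_prod_X_sub_C_pow {K ι : Type*} [Field K] (s : Finset ι) (x : ι → K) (e : ℕ) :
    (∏ i ∈ s, (Polynomial.X - Polynomial.C (x i)) ^ e).natDegree = s.card * e := by
  rw [Polynomial.natDegree_prod_of_monic _ _ fun i _ => (Polynomial.monic_X_sub_C _).pow _]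
  simp

/-- The linear form of a varying point of the moment curve, as a polynomial in the parameter. -/
def momentPoly (K : Type*) [Field K] (n : ℕ) : Polynomial (MvPolynomial (Fin n) K) :=
  ∑ j : Fin n, Polynomial.C (X j) * Polynomial.X ^ (j : ℕ)

/-! ### Functionals on products of moment forms -/

section MomentCurve

variable {K : Type*} [Field K] {n : ℕ}

theorem eval_momentPoly (t : K) :
    (momentPoly K n).eval (algebraMap K (MvPolynomial (Fin n) K) t) = momentForm n t := by
  simp only [momentPoly, momentForm, Polynomial.eval_finsetSum, algebraMap_eq, Polynomial.eval_mul,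
    Polynomial.eval_C, Polynomial.eval_pow, Polynomial.eval_X, C_pow]
  exact Finset.sum_congr rfl fun _ _ => mul_comm _ _

theorem coeff_momentPoly (j : Fin n) : (momentPoly K n).coeff j = X j := by
  simp only [momentPoly, Polynomial.finsetSum_coeff, Polynomial.coeff_C_mul,
    Polynomial.coeff_X_pow, Fin.val_inj]
  simp

theorem natDegree_momentPoly_le : (momentPoly K n).natDegree ≤ n - 1 := by
  refine Polynomial.natDegree_sum_le_of_forall_le _ _ fun j _ => ?_
  exact (Polynomial.natDegree_C_mul_X_pow_le _ _).trans (by omega)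

theorem momentForm_isHomogeneous (t : K) : (momentForm n t).IsHomogeneous 1 := by
  refine IsHomogeneous.sum _ _ _ fun j _ => ?_
  simpa using (isHomogeneous_C (Fin n) (t ^ (j : ℕ))).mul (isHomogeneous_X K j)

/-- In characteristic zero a form of positive degree is a combination of the variables with
coefficients of degree one less. -/
theorem MvPolynomial.IsHomogeneous.exists_eq_sum_X_mul {σ : Type*} [Fintype σ] [CharZero K] {m : ℕ}
    {f : MvPolynomial σ K} (hf : f.IsHomogeneous (m + 1)) :
    ∃ g : σ → MvPolynomial σ K, (∀ i, (g i).IsHomogeneous m) ∧ f = ∑ i, X i * g i := by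
  refine ⟨fun i => ((m + 1 : ℕ) : K)⁻¹ • pderiv i f, fun i => ?_, ?_⟩
  · exact (homogeneousSubmodule σ K m).smul_mem _ (by simpa using hf.pderiv (i := i))
  · have h := hf.sum_X_mul_pderiv
    simp only [mul_smul_comm]
    rw [← Finset.smul_sum, h, ← Nat.cast_smul_eq_nsmul K, smul_smul, inv_mul_cancel₀, one_smul]
    exact Nat.cast_ne_zero.2 m.succ_ne_zero

/-- The products of moment forms over sets avoiding a given finite set span the forms. -/
theorem map_mul_eq_zero_of_prod_momentForm [CharZero K] (L : MvPolynomial (Fin n) K →ₗ[K] K)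
    (m : ℕ) (E : Finset K) (g : MvPolynomial (Fin n) K)
    (h : ∀ S : Finset K, S.card = m → Disjoint S E → L ((∏ t ∈ S, momentForm n t) * g) = 0)
    {f : MvPolynomial (Fin n) K} (hf : f.IsHomogeneous m) : L (f * g) = 0 := by
  classical
  induction m generalizing E g f with
  | zero =>
    rw [totalDegree_eq_zero_iff_eq_C.1 (Nat.le_zero.1 hf.totalDegree_le), ← smul_eq_C_mul, map_smul]
    have := h ∅ rfl (Finset.disjoint_empty_left _)
    rw [Finset.prod_empty, one_mul] at this
    rw [this, smul_zero]
  | succ m ih =>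
    obtain ⟨f', hf', rfl⟩ := hf.exists_eq_sum_X_mul
    rw [Finset.sum_mul, map_sum]
    refine Finset.sum_eq_zero fun j _ => ?_
    -- Trade the variable `X j` for ℓ(t): the polynomial in t vanishes at all t outside `E`, so its
    -- coefficients, where the variables appear, vanish too.
    have hP : coeffwise L (Polynomial.C (f' j * g) * momentPoly K n) = 0 := by
      refine Polynomial.eq_zero_of_infinite_isRoot _
        (E.finite_toSet.infinite_compl.mono fun t ht => ?_)
      rw [Set.mem_ofPred_eq, Polynomial.IsRoot, eval_coeffwise, Polynomial.eval_mul,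
        Polynomial.eval_C, eval_momentPoly, mul_assoc, mul_comm g]
      -- Enlarging `E` by `t` keeps the later points distinct from `t`.
      refine ih (insert t E) _ (fun S hS hSE => ?_) (hf' j)
      rw [Finset.disjoint_insert_right] at hSE
      have := h (insert t S) (by rw [Finset.card_insert_of_notMem hSE.1, hS])
        (Finset.disjoint_insert_left.2 ⟨ht, hSE.2⟩)
      rw [Finset.prod_insert hSE.1] at this
      rw [← this]; congr 1; ring
    have h1 := congrArg (fun p => p.coeff (j : ℕ)) hP
    simp only [coeff_coeffwise, Polynomial.coeff_C_mul, coeff_momentPoly,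
      Polynomial.coeff_zero] at h1
    rw [← h1]; congr 1; ring

/-- A functional supported in one degree kills the multiples of a form as soon as it kills those of
that degree. -/
theorem map_mul_eq_zero_of_supported {σ : Type*} {L : MvPolynomial σ K →ₗ[K] K} {k : ℕ}
    (hL : ∀ d f, d ≠ k → f.IsHomogeneous d → L f = 0) {d : ℕ} {h : MvPolynomial σ K}
    (hh : h.IsHomogeneous d)
    (H : ∀ e f, d + e = k → f.IsHomogeneous e → L (h * f) = 0) (f : MvPolynomial σ K) :
    L (h * f) = 0 := by
  rw [← sum_homogeneousComponent f, Finset.mul_sum, map_sum]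
  refine Finset.sum_eq_zero fun e _ => ?_
  have he := homogeneousComponent_isHomogeneous e f
  by_cases hd : d + e = k
  · exact H e _ hd he
  · exact hL _ _ hd (hh.mul he)

/-- A functional supported in degree `k` that kills the multiples of the squares of the moment forms
of `2k + 1` points kills those of the square of every moment form. -/
theorem map_momentForm_sq_mul_eq_zero [CharZero K] {k : ℕ} (hk : 0 < k)
    {L : MvPolynomial (Fin (2 * k - 1)) K →ₗ[K] K}
    (hL : ∀ d f, d ≠ k → f.IsHomogeneous d → L f = 0)
    {α : Fin ((2 * k - 1) + 2) → K} (hα : Function.Injective α)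
    (h : ∀ i f, L (momentForm (2 * k - 1) (α i) ^ 2 * f) = 0) (s : K)
    (f : MvPolynomial (Fin (2 * k - 1)) K) :
    L (momentForm (2 * k - 1) s ^ 2 * f) = 0 := by
  classical
  -- Descent on the exponent a+2: at c = 0 it is k+1, beyond the degree where L lives.
  suffices H : ∀ c a : ℕ, a + 1 + c = k → ∀ s f, L (momentForm (2 * k - 1) s ^ (a + 2) * f) = 0 from
    H (k - 1) 0 (by omega) s f
  have hpow : ∀ (s : K) a, (momentForm (2 * k - 1) s ^ a).IsHomogeneous a := fun s a => by
    simpa using (momentForm_isHomogeneous s).pow a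
  intro c
  induction c with
  | zero =>
    intro a ha s f
    exact map_mul_eq_zero_of_supported hL (hpow s _) (fun e f he => by omega) f
  | succ c ih =>
    intro a ha s f
    refine map_mul_eq_zero_of_supported hL (hpow s _) (fun e f he hf => ?_) f
    rw [mul_comm _ f]
    refine map_mul_eq_zero_of_prod_momentForm L e (Finset.univ.image α) _ (fun S hS hSE => ?_) hf
    set P := coeffwise L
      (Polynomial.C (∏ t ∈ S, momentForm (2 * k - 1) t) * momentPoly K (2 * k - 1) ^ (a + 2)) with hP
    have hdeg : P.natDegree ≤ (a + 2) * (2 * k - 1 - 1) :=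
      (natDegree_coeffwise_pow_le _ _ _ _).trans (Nat.mul_le_mul_left _ natDegree_momentPoly_le)
    have hS2 : ∏ t ∈ S, (Polynomial.X - Polynomial.C t) ^ 2 ∣ P := by
      refine prod_pow_dvd_of_injOn S id Function.injective_id.injOn 2 P fun t ht => ?_
      have := sq_dvd_coeffwise L (momentPoly K (2 * k - 1)) (n := a + 2) (by omega)
        (fun s f => by rw [eval_momentPoly]; exact ih (a + 1) (by omega) s f)
        (∏ t ∈ S.erase t, momentForm (2 * k - 1) t) t
      rwa [eval_momentPoly, Finset.mul_prod_erase S _ ht] at this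
    have hα2 : ∏ i, (Polynomial.X - Polynomial.C (α i)) ^ (a + 1) ∣ P :=
      prod_pow_dvd_of_injOn Finset.univ α hα.injOn (a + 1) P fun i _ =>
        pow_dvd_coeffwise L _ (fun f => by rw [eval_momentPoly]; exact h i f) _ (a + 1)
    have hcop : IsCoprime (∏ t ∈ S, (Polynomial.X - Polynomial.C t) ^ 2)
        (∏ i, (Polynomial.X - Polynomial.C (α i)) ^ (a + 1)) := by
      refine IsCoprime.prod_left fun t ht => IsCoprime.prod_right fun i _ => IsCoprime.pow ?_
      refine Polynomial.isCoprime_X_sub_C_of_isUnit_sub (sub_ne_zero.2 fun hti => ?_).isUnit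
      exact Finset.disjoint_left.1 hSE ht (hti ▸ Finset.mem_image_of_mem α (Finset.mem_univ i))
    have hS3 := natDegree_prod_X_sub_C_pow S id 2
    simp only [id] at hS3
    have hP0 : P = 0 := by
      refine Polynomial.eq_zero_of_dvd_of_natDegree_lt (hcop.mul_dvd hS2 hα2) ?_
      rw [Polynomial.Monic.natDegree_mul
        (Polynomial.monic_prod_of_monic _ _ fun i _ => (Polynomial.monic_X_sub_C _).pow _)
        (Polynomial.monic_prod_of_monic _ _ fun i _ => (Polynomial.monic_X_sub_C _).pow _),
        hS3, natDegree_prod_X_sub_C_pow, Finset.card_univ,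
        Fintype.card_fin, hS]
      -- With e = k-a-2, the zeros number 2e + (2k+1)(a+1), exceeding (a+2)(2k-2) by a+1.
      refine hdeg.trans_lt ?_
      obtain ⟨k, rfl⟩ := Nat.exists_eq_add_of_lt hk
      have h1 : 2 * (0 + k + 1) - 1 = 2 * k + 1 := by omega
      rw [h1, Nat.add_sub_cancel]
      have h2 : e + a = k + 0 - 1 := by omega
      nlinarith
    have h1 := congrArg (Polynomial.eval s) hP0
    rw [hP, eval_coeffwise, Polynomial.eval_mul, Polynomial.eval_C, Polynomial.eval_pow,
      eval_momentPoly, Polynomial.eval_zero] at h1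
    exact h1

/-- A functional supported in degree `k` that kills the multiples of the squares of all moment forms
and one product of `k` moment forms of distinct points is zero. -/
theorem eq_zero_of_map_prod_momentForm_eq_zero [CharZero K] {k : ℕ}
    {L : MvPolynomial (Fin (2 * k - 1)) K →ₗ[K] K}
    (hL : ∀ d f, d ≠ k → f.IsHomogeneous d → L f = 0)
    (h : ∀ s f, L (momentForm (2 * k - 1) s ^ 2 * f) = 0)
    {S : Finset K} (hS : S.card = k) (h0 : L (∏ t ∈ S, momentForm (2 * k - 1) t) = 0) : L = 0 := by
  classical
  have exch : ∀ (T : Finset K) (s t : K), T.card + 1 = k → s ∉ T → t ∉ T →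
      L (∏ r ∈ insert s T, momentForm (2 * k - 1) r) = 0 →
      L (∏ r ∈ insert t T, momentForm (2 * k - 1) r) = 0 := by
    intro T s t hT hs ht h0
    set P := coeffwise L
      (Polynomial.C (∏ t ∈ T, momentForm (2 * k - 1) t) * momentPoly K (2 * k - 1) ^ 1) with hP
    have hev : ∀ s, s ∉ T → P.eval s = L (∏ r ∈ insert s T, momentForm (2 * k - 1) r) := by
      intro s hs
      rw [hP, eval_coeffwise, Polynomial.eval_mul, Polynomial.eval_C, pow_one, eval_momentPoly,
        Finset.prod_insert hs, mul_comm (momentForm _ s)]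
    have hdeg : P.natDegree ≤ 1 * (2 * k - 1 - 1) :=
      (natDegree_coeffwise_pow_le _ _ _ _).trans (Nat.mul_le_mul_left _ natDegree_momentPoly_le)
    have hT2 : ∏ t ∈ T, (Polynomial.X - Polynomial.C t) ^ 2 ∣ P := by
      refine prod_pow_dvd_of_injOn T id Function.injective_id.injOn 2 P fun t ht => ?_
      have := sq_dvd_coeffwise L (momentPoly K (2 * k - 1)) (n := 1) one_pos
        (fun s f => by rw [eval_momentPoly]; exact h s f)
        (∏ t ∈ T.erase t, momentForm (2 * k - 1) t) t
      rwa [eval_momentPoly, Finset.mul_prod_erase T _ ht] at this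
    have hs2 : Polynomial.X - Polynomial.C s ∣ P := by
      rw [Polynomial.dvd_iff_isRoot, Polynomial.IsRoot, hev s hs, h0]
    have hcop : IsCoprime (∏ t ∈ T, (Polynomial.X - Polynomial.C t) ^ 2)
        (Polynomial.X - Polynomial.C s) := by
      refine IsCoprime.prod_left fun t ht => IsCoprime.pow_left ?_
      exact Polynomial.isCoprime_X_sub_C_of_isUnit_sub
        (sub_ne_zero.2 fun hts : t = s => hs (hts.subst (motive := (· ∈ T)) ht)).isUnit
    -- Double zeros at k-1 points and one at `s` make 2k-1 zeros, against degree at most 2k-2.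
    have hP0 : P = 0 := by
      refine Polynomial.eq_zero_of_dvd_of_natDegree_lt (hcop.mul_dvd hT2 hs2) ?_
      rw [Polynomial.Monic.natDegree_mul
        (Polynomial.monic_prod_of_monic _ _ fun i _ => (Polynomial.monic_X_sub_C _).pow _)
        (Polynomial.monic_X_sub_C _), Polynomial.natDegree_X_sub_C]
      have hT3 := natDegree_prod_X_sub_C_pow T id 2
      simp only [id] at hT3
      rw [hT3]
      omega
    rw [← hev t ht, hP0, Polynomial.eval_zero]
  -- Any k-set is reached from `S` by exchanging one point at a time.
  have all : ∀ (N : ℕ) (T : Finset K), T.card = k → (T \ S).card = N →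
      L (∏ t ∈ T, momentForm (2 * k - 1) t) = 0 := by
    intro N
    induction N with
    | zero =>
      intro T hT hN
      rw [Finset.card_eq_zero, Finset.sdiff_eq_empty_iff_subset] at hN
      rwa [Finset.eq_of_subset_of_card_le hN (by omega)]
    | succ N ih =>
      intro T hT hN
      obtain ⟨t, ht⟩ : (T \ S).Nonempty := Finset.card_pos.1 (by omega)
      have hc : (S \ T).card = (T \ S).card := Finset.card_sdiff_comm (by omega)
      obtain ⟨s, hs⟩ : (S \ T).Nonempty := Finset.card_pos.1 (by omega)
      rw [Finset.mem_sdiff] at ht hs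
      have hcard := Finset.card_erase_add_one ht.1
      have hsT : s ∉ T.erase t := fun hh => hs.2 (Finset.mem_of_mem_erase hh)
      have h1 := ih (insert s (T.erase t)) (by rw [Finset.card_insert_of_notMem hsT]; omega) (by
        rw [Finset.insert_sdiff_of_mem _ hs.1, Finset.erase_sdiff_comm,
          Finset.card_erase_of_mem (Finset.mem_sdiff.2 ht), hN]
        rfl)
      have h2 := exch (T.erase t) s t (by omega) hsT (Finset.notMem_erase _ _) h1
      rwa [Finset.insert_erase ht.1] at h2
  refine LinearMap.ext fun f => ?_
  rw [LinearMap.zero_apply, ← one_mul f]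
  refine map_mul_eq_zero_of_supported hL (isHomogeneous_one _ _) (fun e f he hf => ?_) f
  rw [mul_comm _ f]
  exact map_mul_eq_zero_of_prod_momentForm L e ∅ 1
    (fun T hT _ => by rw [mul_one]; exact all _ T (by omega) rfl) hf

end MomentCurve

/-! ### Forms as functionals -/

section Apolarity

variable {σ K : Type*} [Field K]

/-- The functional `f ↦ (f ∘ G)(0)`. -/
def apolarFunctional (G : MvPolynomial σ K) : MvPolynomial σ K →ₗ[K] K :=
  lcoeff K 0 ∘ₗ LinearMap.applyₗ G ∘ₗ (diffAction σ K).toLinearMap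

theorem apolarFunctional_apply (G f : MvPolynomial σ K) :
    apolarFunctional G f = coeff 0 (diffAction σ K f G) := rfl

theorem apolarFunctional_sub_smul (G F : MvPolynomial σ K) (c : K) :
    apolarFunctional (G - c • F) = apolarFunctional G - c • apolarFunctional F := by
  refine LinearMap.ext fun f => ?_
  simp [apolarFunctional_apply]

theorem apolarFunctional_X_mul (G f : MvPolynomial σ K) (j : σ) :
    apolarFunctional G (X j * f) = apolarFunctional (pderiv j G) f := by
  rw [apolarFunctional_apply, apolarFunctional_apply, mul_comm, map_mul, Module.End.mul_apply,
    diffAction_X]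

theorem apolarFunctional_mul_eq_zero {G h : MvPolynomial σ K} (hG : diffAction σ K h G = 0)
    (f : MvPolynomial σ K) : apolarFunctional G (h * f) = 0 := by
  rw [apolarFunctional_apply, mul_comm, map_mul, Module.End.mul_apply, hG, map_zero, coeff_zero]

theorem MvPolynomial.IsHomogeneous.eq_C {f : MvPolynomial σ K} (hf : f.IsHomogeneous 0) :
    f = C (coeff 0 f) :=
  totalDegree_eq_zero_iff_eq_C.1 (Nat.le_zero.1 hf.totalDegree_le)

theorem apolarFunctional_eq_zero_of_ne [Fintype σ] [CharZero K] {k d : ℕ} {G f : MvPolynomial σ K}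
    (hG : G.IsHomogeneous k) (hf : f.IsHomogeneous d) (hd : d ≠ k) :
    apolarFunctional G f = 0 := by
  induction d generalizing k G f with
  | zero =>
    rw [hf.eq_C, apolarFunctional_apply, ← algebraMap_eq, AlgHom.commutes,
      Module.algebraMap_end_apply, coeff_smul, hG.coeff_eq_zero (by simpa using hd), smul_zero]
  | succ d ih =>
    obtain ⟨g, hg, rfl⟩ := hf.exists_eq_sum_X_mul
    rw [map_sum]
    refine Finset.sum_eq_zero fun j _ => ?_
    rw [apolarFunctional_X_mul]
    rcases k with _ | k
    · rw [hG.eq_C, pderiv_C, apolarFunctional_apply, map_zero, coeff_zero]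
    · exact ih (by simpa using hG.pderiv (i := j)) (hg j) (by omega)

/-- By induction all partial derivatives vanish; Euler's identity in characteristic zero then gives
G = 0. -/
theorem eq_zero_of_apolarFunctional_eq_zero [Fintype σ] [CharZero K] {k : ℕ} {G : MvPolynomial σ K}
    (hG : G.IsHomogeneous k) (h : apolarFunctional G = 0) : G = 0 := by
  induction k generalizing G with
  | zero =>
    have h1 := LinearMap.congr_fun h 1
    rw [apolarFunctional_apply, map_one, Module.End.one_apply, LinearMap.zero_apply] at h1
    rw [hG.eq_C, h1, C_0]
  | succ k ih =>
    have h1 : ∀ j, pderiv j G = 0 := fun j => ih (by simpa using hG.pderiv (i := j)) <|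
      LinearMap.ext fun f => by
        rw [← apolarFunctional_X_mul, h, LinearMap.zero_apply, LinearMap.zero_apply]
    have h2 := hG.sum_X_mul_pderiv
    simp only [h1, mul_zero, Finset.sum_const_zero] at h2
    exact (smul_eq_zero.1 h2.symm).resolve_left k.succ_ne_zero

end Apolarity

/-! ### The Hankel determinant -/

section Hankel

variable {K : Type*} [Field K]

/-- The derivative in the direction of a point of the moment curve. -/
def momentDerivation (K : Type*) [Field K] (n : ℕ) (t : K) :
    Derivation K (MvPolynomial (Fin n) K) (MvPolynomial (Fin n) K) :=
  ∑ j : Fin n, t ^ (j : ℕ) • pderiv j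

theorem momentDerivation_apply {n : ℕ} (t : K) (G : MvPolynomial (Fin n) K) :
    momentDerivation K n t G = ∑ j : Fin n, t ^ (j : ℕ) • pderiv j G := by
  have h : ⇑(momentDerivation K n t) = ∑ j : Fin n, ⇑(t ^ (j : ℕ) • pderiv (R := K) j) :=
    map_sum Derivation.coeFnAddMonoidHom _ _
  rw [h, Finset.sum_apply]
  rfl

theorem momentDerivation_X {n : ℕ} (t : K) (j : Fin n) :
    momentDerivation K n t (X j) = C (t ^ (j : ℕ)) := by
  classical
  rw [momentDerivation_apply, Finset.sum_eq_single j]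
  · simp [smul_eq_C_mul]
  · intro i _ hij
    rw [pderiv_X_of_ne hij.symm, smul_zero]
  · simp

theorem diffAction_momentForm {n : ℕ} (t : K) (G : MvPolynomial (Fin n) K) :
    diffAction (Fin n) K (momentForm n t) G = momentDerivation K n t G := by
  rw [momentDerivation_apply, momentForm, map_sum, LinearMap.sum_apply]
  refine Finset.sum_congr rfl fun j _ => ?_
  rw [map_mul, Module.End.mul_apply, diffAction_X, ← algebraMap_eq, AlgHom.commutes,
    Module.algebraMap_end_apply]

theorem Derivation.map_det_eq_zero {ι R A : Type*} [Fintype ι] [DecidableEq ι] [CommRing R]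
    [CommRing A] [Algebra R A] (D : Derivation R A A) {M : Matrix ι ι A}
    (h : ∀ i j, D (M i j) = 0) : D M.det = 0 := by
  rw [Matrix.det_apply, map_sum]
  refine Finset.sum_eq_zero fun τ _ => ?_
  have hprod : ∀ s : Finset ι, D (∏ i ∈ s, M (τ i) i) = 0 := by
    intro s
    induction s using Finset.induction_on with
    | empty => simp
    | insert i s hi ih => rw [Finset.prod_insert hi, D.leibniz, ih, h, smul_zero, smul_zero, add_zero]
  rw [Units.smul_def, map_zsmul, hprod, smul_zero]

theorem hankelMatrix_det_isHomogeneous (k : ℕ) : (hankelMatrix K k).det.IsHomogeneous k := by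
  rw [Matrix.det_apply]
  refine IsHomogeneous.sum _ _ _ fun τ _ => ?_
  have h : (∏ i, hankelMatrix K k (τ i) i).IsHomogeneous (∑ _i : Fin k, 1) :=
    IsHomogeneous.prod _ _ _ fun i _ => isHomogeneous_X K _
  rw [Finset.sum_const, Finset.card_univ, Fintype.card_fin, smul_eq_mul, mul_one] at h
  rw [Units.smul_def, ← Int.cast_smul_eq_zsmul K]
  exact (homogeneousSubmodule _ K k).smul_mem _ h

theorem hankelMatrix_det_ne_zero (k : ℕ) : (hankelMatrix K k).det ≠ 0 := by
  intro h
  -- Specialising the variables to the antidiagonal gives a permutation matrix.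
  have h1 := congrArg (eval fun j : Fin (2 * k - 1) => if (j : ℕ) + 1 = k then (1 : K) else 0) h
  rw [RingHom.map_det, map_zero] at h1
  have h2 : (eval fun j : Fin (2 * k - 1) => if (j : ℕ) + 1 = k then (1 : K) else 0).mapMatrix
      (hankelMatrix K k) = (1 : Matrix (Fin k) (Fin k) K).submatrix Fin.revPerm id := by
    ext i j
    have : (i : ℕ) + j + 1 = k ↔ Fin.rev i = j := by
      rw [Fin.ext_iff, Fin.val_rev]; omega
    simp [hankelMatrix, Matrix.one_apply, this]
  rw [h2, Matrix.det_permute, Matrix.det_one, mul_one] at h1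
  rcases Int.units_eq_one_or (Equiv.Perm.sign (Fin.revPerm (n := k))) with h3 | h3 <;>
    simp [h3] at h1

/-- Let D be the derivative along ℓ(t). It sends entry (i, j) to t^(i+j), so subtracting t times the
previous row makes every row but the first D-constant. The determinant is linear in that first row,
whose entries D^2 kills. -/
theorem diffAction_momentForm_sq_hankelMatrix_det {k : ℕ} (hk : 0 < k) (t : K) :
    diffAction (Fin (2 * k - 1)) K (momentForm (2 * k - 1) t ^ 2) (hankelMatrix K k).det = 0 := by
  rw [pow_two, map_mul, Module.End.mul_apply, diffAction_momentForm, diffAction_momentForm]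
  obtain ⟨m, rfl⟩ := Nat.exists_eq_succ_of_ne_zero hk.ne'
  set D := momentDerivation K (2 * m.succ - 1) t
  let M : Matrix (Fin (m + 1)) (Fin (m + 1)) (MvPolynomial (Fin (2 * m.succ - 1)) K) :=
    Matrix.of (Fin.cons (hankelMatrix K (m + 1) 0) fun i j =>
      hankelMatrix K (m + 1) i.succ j - C t * hankelMatrix K (m + 1) i.castSucc j)
  have hD : ∀ i j, D (hankelMatrix K (m + 1) i j) = C (t ^ ((i : ℕ) + j)) := fun i j =>
    momentDerivation_X t _
  have hdet : (hankelMatrix K (m + 1)).det = M.det :=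
    Matrix.det_eq_of_forall_row_eq_smul_add_pred (fun _ => C t) (fun _ => rfl)
      fun i j => (sub_add_cancel _ _).symm
  have hM : ∀ (i : Fin m) j, D (M i.succ j) = 0 := by
    intro i j
    change D (hankelMatrix K (m + 1) i.succ j - C t * hankelMatrix K (m + 1) i.castSucc j) = 0
    rw [map_sub, ← smul_eq_C_mul, D.map_smul, hD, hD, smul_eq_C_mul, ← C_mul, Fin.val_succ,
      Fin.val_castSucc, ← pow_succ', Nat.add_right_comm, sub_self]
  change D (D (hankelMatrix K (m + 1)).det) = 0
  rw [hdet, Matrix.det_succ_row_zero, map_sum, map_sum]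
  refine Finset.sum_eq_zero fun j _ => ?_
  have hminor : D (M.submatrix Fin.succ j.succAbove).det = 0 :=
    D.map_det_eq_zero fun i j' => hM i _
  have hsign : D ((-1) ^ (j : ℕ)) = 0 := by
    rw [D.leibniz_pow, map_neg, D.map_one_eq_zero]; simp
  have h0 : D (M 0 j) = C (t ^ (0 + (j : ℕ))) := hD 0 j
  have hC : ∀ c : K, D (C c) = 0 := fun c => D.map_algebraMap c
  simp only [D.leibniz, hminor, hsign, h0, hC, add_zero, zero_add, smul_eq_mul, mul_zero]

end Hankel

end

theorem theorem5p2 {K : Type*} [Field K] [CharZero K] (k : ℕ) (hk : 0 < k)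
    (α : Fin ((2 * k - 1) + 2) → K) (hα : Function.Injective α) :
    (hankelMatrix K k).det ≠ 0 ∧
    (hankelMatrix K k).det.IsHomogeneous k ∧
    (∀ i, diffAction (Fin (2 * k - 1)) K (momentForm (2 * k - 1) (α i) ^ 2)
      (hankelMatrix K k).det = 0) ∧
    ∀ G : MvPolynomial (Fin (2 * k - 1)) K, G.IsHomogeneous k →
      (∀ i, diffAction (Fin (2 * k - 1)) K (momentForm (2 * k - 1) (α i) ^ 2) G = 0) →
      ∃ c : K, G = c • (hankelMatrix K k).det := by
  refine ⟨hankelMatrix_det_ne_zero k, hankelMatrix_det_isHomogeneous k,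
    fun i => diffAction_momentForm_sq_hankelMatrix_det hk _, fun G hG hGα => ?_⟩
  have hF := hankelMatrix_det_isHomogeneous (K := K) k
  have hF0 := hankelMatrix_det_ne_zero (K := K) k
  have hFsq := diffAction_momentForm_sq_hankelMatrix_det (K := K) hk
  set F := (hankelMatrix K k).det
  obtain ⟨S, hS⟩ := Infinite.exists_subset_card_eq K k
  -- Otherwise the vanishing criterion would give F = 0; hence a multiple of F can be subtracted
  -- from G to reach its hypothesis.
  have hFS : apolarFunctional F (∏ t ∈ S, momentForm (2 * k - 1) t) ≠ 0 := fun h =>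
    hF0 <| eq_zero_of_apolarFunctional_eq_zero hF <| eq_zero_of_map_prod_momentForm_eq_zero
      (fun d f hd hf => apolarFunctional_eq_zero_of_ne hF hf hd)
      (fun s => apolarFunctional_mul_eq_zero (hFsq s)) hS h
  set c := apolarFunctional G (∏ t ∈ S, momentForm (2 * k - 1) t) /
    apolarFunctional F (∏ t ∈ S, momentForm (2 * k - 1) t) with hc
  refine ⟨c, sub_eq_zero.1 ?_⟩
  have hH : (G - c • F).IsHomogeneous k :=
    hG.sub ((MvPolynomial.homogeneousSubmodule _ K k).smul_mem c hF)
  have hL : ∀ d f, d ≠ k → f.IsHomogeneous d → apolarFunctional (G - c • F) f = 0 :=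
    fun d f hd hf => apolarFunctional_eq_zero_of_ne hH hf hd
  refine eq_zero_of_apolarFunctional_eq_zero hH (eq_zero_of_map_prod_momentForm_eq_zero hL
    (map_momentForm_sq_mul_eq_zero hk hL hα fun i => apolarFunctional_mul_eq_zero ?_) hS ?_)
  · rw [map_sub, map_smul, hGα, hFsq, smul_zero, sub_zero]
  · rw [apolarFunctional_sub_smul, LinearMap.sub_apply, LinearMap.smul_apply, smul_eq_mul, hc,
      div_mul_cancel₀ _ hFS, sub_self]
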